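/- Let $n\ge 0$ be an integer, let $p\in[1,\infty)$, and let $A=(a_{i,j})$ be an $n\times n$ real matrix with nonnegative entries and rows $R_1,\dots,R_n$. Write $\mathrm{perm}(A)=\sum_{\sigma\in S_n}\prod_{i=1}^n a_{i,\sigma(i)}$ for the permanent of $A$ and $\|R_i\|_p=\big(\sum_j a_{i,j}^p\big)^{1/p}$ for the $\ell_p$-norm (with the conventions $0^0=1$ and empty product $=1$ when $n=0$). Then $$\mathrm{perm}(A)\le \max\Big\{1,\frac{n!}{n^{n/p}}\Big\}\prod_{i=1}^n\|R_i\|_p .$$ Moreover, if $(n,p)\ne(2,2)$ and no row of $A$ is zero, then equality holds if and only if at least one of the following is true: (i) $n!/n^{n/p}\le 1$ and $A$ is, up to a permutation of its rows and multiplication of each row by a positive scalar, the identity matrix; (ii) $n!/n^{n/p}\ge 1$ and $A$ is, up to multiplication of each row by a positive scalar, the all-ones matrix. -/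

import Mathlib

open Real Set

/-! The proof is an entropy argument. Draw a permutation σ with probability proportional to ∏ A i (σ
i). Then log perm A is the entropy H(σ) plus ∑ E log A i (σ i). The key inequality,
`massEntropy_le_critRate`, is H(σ) ≤ δ ∑ H(σ i) with δ = `critRate n`, sharp for uniform σ. It
decouples the rows: Gibbs' inequality bounds (1/p) H(σ i) + E log A i (σ i) by the log of the row
norm, and the remainder (δ - 1/p) H(σ i) is at most max(0, (δ - 1/p) log n) because 0 ≤ H ≤ log n.

The entropy inequality goes by induction on n: reveal σ r, apply the induction hypothesis to the
rest, and sum over r. For fixed i and b the events σ r = b, r ≠ i, partition the event σ i ≠ b, so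
concavity of entropy merges the conditional laws of σ i into its law given σ i ≠ b. What remains
concerns one distribution q on m + 1 points: ∑ η(1 - q j) ≥ γ ∑ η(q j) with γ = `complRatio m`
(`sum_complGap_nonneg`), a tangent-line argument for a convex-then-concave function.

For equality with δ ≠ 1/p, the row estimate forces each σ i to be deterministic or each to be
uniform. If δ = 1/p and n ≥ 3, equality in the one-distribution inequality leaves the same two
options per row, and they cannot mix. For two points that inequality is always an equality, hence
the exception (2, 2). -/

/-! ### The gap function of one variable -/

/-- The minimal ratio `∑ η(1 - q) / ∑ η(q)` over distributions on `m + 1` points,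
where `η = negMulLog`; it is attained at the uniform distribution. -/
noncomputable def complRatio (m : ℝ) : ℝ := m * log ((m + 1) / m) / log (m + 1)

/-- The difference between the entropy term of `1 - x` and the rescaled entropy term of `x`. -/
noncomputable def complGap (m x : ℝ) : ℝ :=
  negMulLog (1 - x) - complRatio m * negMulLog x

theorem one_lt_log_add_one {m : ℝ} (hm : 2 ≤ m) : 1 < log (m + 1) := by
  rw [lt_log_iff_exp_lt (by linarith)]
  linarith [exp_one_lt_d9]

theorem complRatio_lt_one {m : ℝ} (hm : 2 ≤ m) : complRatio m < 1 := by
  have h1 := one_lt_log_add_one hm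
  rw [complRatio, div_lt_one (by linarith)]
  have h2 := log_le_sub_one_of_pos (x := (m + 1) / m) (by positivity)
  have h3 : m * ((m + 1) / m - 1) = 1 := by field_simp; ring
  nlinarith

/-- This puts 1/(m+1) in the convex range of `complGap`, and the inflection point of `twoLevelGap`
to the left of 1/(m+1). -/
theorem one_lt_mul_complRatio {m : ℝ} (hm : 2 ≤ m) : 1 < m * complRatio m := by
  have h1 := one_lt_log_add_one hm
  rw [complRatio, mul_div_assoc', one_lt_div (by linarith)]
  have h2 := one_sub_inv_le_log_of_pos (x := (m + 1) / m) (by positivity)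
  have h3 : 1 - ((m + 1) / m)⁻¹ = 1 / (m + 1) := by field_simp; ring
  -- The tangent of log at 3: the case m = 2 is tight, needing log 3 < 4/3.
  have h4 : log (m + 1) ≤ 1.2 + (m - 2) / 3 := by
    have h5 : log (m + 1) = log 3 + log ((m + 1) / 3) := by
      rw [← log_mul (by norm_num) (by positivity)]; congr 1; ring
    have h6 := log_le_sub_one_of_pos (x := (m + 1) / 3) (by positivity)
    have h7 : log 3 ≤ 1.2 := by
      rw [log_le_iff_le_exp (by norm_num), show (1.2 : ℝ) = 1 + 0.2 by norm_num, exp_add]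
      have := add_one_le_exp (0.2 : ℝ)
      nlinarith [exp_one_gt_d9]
    linarith
  have h12 : m * (m * (1 / (m + 1))) ≤ m * (m * log ((m + 1) / m)) := by
    rw [h3] at h2
    gcongr
  refine lt_of_le_of_lt h4 (lt_of_lt_of_le ?_ h12)
  have : m * (m * (1 / (m + 1))) = m - 1 + 1 / (m + 1) := by field_simp; ring
  rw [this]
  have h13 : (1 / (m + 1)) * (m + 1) = 1 := by field_simp
  have h14 : 0 < 1 / (m + 1) := by positivity
  by_contra h
  nlinarith

theorem complRatio_pos {m : ℝ} (hm : 2 ≤ m) : 0 < complRatio m := by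
  have := one_lt_mul_complRatio hm
  by_contra h
  nlinarith

theorem continuous_complGap (m : ℝ) : Continuous (complGap m) := by
  unfold complGap
  have := continuous_negMulLog
  fun_prop

theorem complGap_zero (m : ℝ) : complGap m 0 = 0 := by simp [complGap]

theorem complGap_one (m : ℝ) : complGap m 1 = 0 := by simp [complGap]

theorem complGap_uniform {m : ℝ} (hm : 2 ≤ m) : complGap m (1 / (m + 1)) = 0 := by
  have h1 := one_lt_log_add_one hm
  have h2 : 1 - 1 / (m + 1) = ((m + 1) / m)⁻¹ := by field_simp; ring
  rw [complGap, h2, complRatio, negMulLog, negMulLog, one_div, log_inv, log_inv]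
  field_simp
  ring

theorem hasDerivAt_complGap (m : ℝ) {x : ℝ} (h0 : x ≠ 0) (h1 : 1 - x ≠ 0) :
    HasDerivAt (complGap m) (log (1 - x) + 1 + complRatio m * (log x + 1)) x := by
  have a := (hasDerivAt_negMulLog h1).comp x ((hasDerivAt_id x).const_sub 1)
  have b := (hasDerivAt_negMulLog h0).const_mul (complRatio m)
  refine (a.sub b).congr_deriv ?_
  ring

/-- The second derivative γ/x - 1/(1 - x) changes sign exactly at γ/(1 + γ). -/
theorem convexOn_complGap {m : ℝ} (hm : 2 ≤ m) :
    ConvexOn ℝ (Icc 0 (complRatio m / (1 + complRatio m))) (complGap m) := by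
  have hγ := complRatio_pos hm
  have hle : complRatio m / (1 + complRatio m) < 1 := by rw [div_lt_one] <;> linarith
  refine MonotoneOn.convexOn_of_deriv (convex_Icc _ _) (continuous_complGap m).continuousOn ?_ ?_
  · rw [interior_Icc]
    intro x hx
    exact (hasDerivAt_complGap m hx.1.ne' (by linarith [hx.2])).differentiableAt.differentiableWithinAt
  · rw [interior_Icc]
    have key : MonotoneOn (fun x => log (1 - x) + 1 + complRatio m * (log x + 1))
        (Ioo 0 (complRatio m / (1 + complRatio m))) := by
      have hd : ∀ x ∈ Ioo 0 (complRatio m / (1 + complRatio m)),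
          HasDerivAt (fun x => log (1 - x) + 1 + complRatio m * (log x + 1))
            (-1 / (1 - x) + complRatio m * (1 / x)) x := by
        intro x hx
        have h1 : (1 : ℝ) - x ≠ 0 := by linarith [hx.2]
        have a := (((hasDerivAt_id x).const_sub 1).log h1).add_const 1
        have b := (((hasDerivAt_id x).log hx.1.ne').add_const 1).const_mul (complRatio m)
        exact (a.add b).congr_deriv (by simp)
      refine monotoneOn_of_hasDerivWithinAt_nonneg (convex_Ioo _ _)
        (fun x hx => (hd x hx).continuousAt.continuousWithinAt)
        (fun x hx => (hd x (interior_subset hx)).hasDerivWithinAt) ?_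
      intro x hx
      rw [interior_Ioo] at hx
      have h1 : 0 < (1 : ℝ) - x := by linarith [hx.2]
      have h2 := hx.2
      rw [lt_div_iff₀ (by linarith)] at h2
      have : -1 / (1 - x) + complRatio m * (1 / x) =
          (complRatio m * (1 - x) - x) / (x * (1 - x)) := by
        have := hx.1.ne'
        field_simp
        ring
      rw [this]
      exact div_nonneg (by linarith) (mul_pos hx.1 h1).le
    refine key.congr fun x hx => ?_
    exact (hasDerivAt_complGap m hx.1.ne' (by linarith [hx.2])).deriv.symm

theorem concaveOn_complGap {m : ℝ} (hm : 2 ≤ m) :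
    ConcaveOn ℝ (Icc (complRatio m / (1 + complRatio m)) 1) (complGap m) := by
  have hγ := complRatio_pos hm
  have h0 : 0 < complRatio m / (1 + complRatio m) := by positivity
  refine AntitoneOn.concaveOn_of_deriv (convex_Icc _ _) (continuous_complGap m).continuousOn ?_ ?_
  · rw [interior_Icc]
    intro x hx
    exact (hasDerivAt_complGap m (h0.trans hx.1).ne'
      (by linarith [hx.2])).differentiableAt.differentiableWithinAt
  · rw [interior_Icc]
    have key : AntitoneOn (fun x => log (1 - x) + 1 + complRatio m * (log x + 1))
        (Ioo (complRatio m / (1 + complRatio m)) 1) := by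
      have hd : ∀ x ∈ Ioo (complRatio m / (1 + complRatio m)) 1,
          HasDerivAt (fun x => log (1 - x) + 1 + complRatio m * (log x + 1))
            (-1 / (1 - x) + complRatio m * (1 / x)) x := by
        intro x hx
        have h1 : (1 : ℝ) - x ≠ 0 := by linarith [hx.2]
        have a := (((hasDerivAt_id x).const_sub 1).log h1).add_const 1
        have b := (((hasDerivAt_id x).log (h0.trans hx.1).ne').add_const 1).const_mul (complRatio m)
        exact (a.add b).congr_deriv (by simp)
      refine antitoneOn_of_hasDerivWithinAt_nonpos (convex_Ioo _ _)
        (fun x hx => (hd x hx).continuousAt.continuousWithinAt)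
        (fun x hx => (hd x (interior_subset hx)).hasDerivWithinAt) ?_
      intro x hx
      rw [interior_Ioo] at hx
      have h1 : 0 < (1 : ℝ) - x := by linarith [hx.2]
      have h3 : 0 < x := h0.trans hx.1
      have h2 := hx.1
      rw [div_lt_iff₀ (by linarith)] at h2
      have : -1 / (1 - x) + complRatio m * (1 / x) =
          (complRatio m * (1 - x) - x) / (x * (1 - x)) := by
        have := h3.ne'
        field_simp
        ring
      rw [this]
      exact div_nonpos_of_nonpos_of_nonneg (by linarith) (mul_pos h3 h1).le
    refine key.congr fun x hx => ?_
    exact (hasDerivAt_complGap m (h0.trans hx.1).ne' (by linarith [hx.2])).deriv.symm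

/-! ### Two-level distributions -/

/-- The value of `∑ j, complGap m (q j)` at the distribution `(1 - m x, x, …, x)`. -/
noncomputable def twoLevelGap (m x : ℝ) : ℝ := m * complGap m x + complGap m (1 - m * x)

/-- The derivative of `twoLevelGap m`, up to the factor `m`. -/
noncomputable def twoLevelSlope (m x : ℝ) : ℝ :=
  log (1 - x) + complRatio m * log x - log (m * x) - complRatio m * log (1 - m * x)

theorem hasDerivAt_twoLevelGap {m : ℝ} (hm : 2 ≤ m) {x : ℝ} (h0 : 0 < x)
    (h1 : 0 < 1 - m * x) : HasDerivAt (twoLevelGap m) (m * twoLevelSlope m x) x := by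
  have h2 : 0 < 1 - x := by nlinarith
  have h3 : 0 < m * x := by positivity
  have a := (hasDerivAt_complGap m h0.ne' h2.ne').const_mul m
  have b := (hasDerivAt_complGap m (x := 1 - m * x) h1.ne' (by simpa using h3.ne')).comp x
    (((hasDerivAt_id x).const_mul m).const_sub 1)
  refine (a.add b).congr_deriv ?_
  rw [twoLevelSlope, sub_sub_cancel]
  ring

theorem hasDerivAt_twoLevelSlope {m : ℝ} (hm : 2 ≤ m) {x : ℝ} (h0 : 0 < x)
    (h1 : 0 < 1 - m * x) : HasDerivAt (twoLevelSlope m)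
      (((m - complRatio m) * x - (1 - complRatio m)) / (x * (1 - x) * (1 - m * x))) x := by
  have h2 : 0 < 1 - x := by nlinarith
  have h3 : 0 < m * x := by positivity
  have i := hasDerivAt_id x
  have a := (i.const_sub 1).log h2.ne'
  have b := (i.log h0.ne').const_mul (complRatio m)
  have c := (i.const_mul m).log h3.ne'
  have d := (((i.const_mul m).const_sub 1).log h1.ne').const_mul (complRatio m)
  refine (((a.add b).sub c).sub d).congr_deriv ?_
  simp only [id]
  have h4 : 1 - x * m ≠ 0 := by rw [mul_comm]; exact h1.ne'
  have h5 : m ≠ 0 := by linarith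
  rw [mul_comm m x]
  field_simp
  ring

/-- On [c, 1/(m+1)] the slope increases to 0, so the gap decreases to its value 0 at the uniform
point. On [0, c] the gap is concave, zero at 0 and positive at c. -/
theorem twoLevelGap_pos {m : ℝ} (hm : 2 ≤ m) {x : ℝ} (h0 : 0 < x) (hx : x < 1 / (m + 1)) :
    0 < twoLevelGap m x := by
  have hγ1 := complRatio_lt_one hm
  have hγm := one_lt_mul_complRatio hm
  set b : ℝ := 1 / (m + 1) with hb
  have hbm : b * (m + 1) = 1 := by rw [hb]; field_simp
  have hb0 : 0 < b := by positivity
  -- The zero of the derivative of `twoLevelSlope`.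
  set c : ℝ := (1 - complRatio m) / (m - complRatio m) with hc
  have hmγ : 0 < m - complRatio m := by linarith
  have hcm : c * (m - complRatio m) = 1 - complRatio m := div_mul_cancel₀ _ hmγ.ne'
  have hc0 : 0 < c := div_pos (by linarith) hmγ
  have hcb : c < b := by
    rw [hc, hb, div_lt_div_iff₀ hmγ (by linarith)]
    nlinarith
  have hsub : ∀ z, z ≤ b → 0 < 1 - m * z := fun z hz => by nlinarith
  have hcont : Continuous (twoLevelGap m) := by
    unfold twoLevelGap
    have := continuous_complGap m
    fun_prop
  have hgb : twoLevelGap m b = 0 := by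
    have : 1 - m * b = b := by linarith
    rw [twoLevelGap, this, hb, complGap_uniform hm]; simp
  have hkb : twoLevelSlope m b = 0 := by
    have e1 : 1 - m * b = b := by linarith
    have e2 : 1 - b = m * b := by linarith
    rw [twoLevelSlope, e1, e2]; ring
  have hmono : StrictMonoOn (twoLevelSlope m) (Icc c b) := by
    refine strictMonoOn_of_deriv_pos (convex_Icc _ _) (fun z hz =>
      (hasDerivAt_twoLevelSlope hm (hc0.trans_le hz.1)
        (hsub z hz.2)).continuousAt.continuousWithinAt) ?_
    rw [interior_Icc]
    intro z hz
    have h1 : 0 < z := hc0.trans hz.1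
    have h2 := hsub z hz.2.le
    rw [(hasDerivAt_twoLevelSlope hm h1 h2).deriv]
    have h3 : 0 < 1 - z := by nlinarith
    apply div_pos
    · nlinarith [hz.1]
    · positivity
  have hanti : StrictAntiOn (twoLevelGap m) (Icc c b) := by
    refine strictAntiOn_of_deriv_neg (convex_Icc _ _) hcont.continuousOn ?_
    rw [interior_Icc]
    intro z hz
    rw [(hasDerivAt_twoLevelGap hm (hc0.trans hz.1) (hsub z hz.2.le)).deriv]
    have := hmono (Ioo_subset_Icc_self hz) (right_mem_Icc.2 hcb.le) hz.2
    nlinarith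
  by_cases hxc : c ≤ x
  · have := hanti ⟨hxc, hx.le⟩ (right_mem_Icc.2 hcb.le) hx
    linarith
  push Not at hxc
  have hgc : 0 < twoLevelGap m c := by
    have := hanti (left_mem_Icc.2 hcb.le) (right_mem_Icc.2 hcb.le) hcb
    linarith
  have hconc : ConcaveOn ℝ (Icc 0 c) (twoLevelGap m) := by
    refine AntitoneOn.concaveOn_of_deriv (convex_Icc _ _) hcont.continuousOn ?_ ?_
    · rw [interior_Icc]
      intro z hz
      exact (hasDerivAt_twoLevelGap hm hz.1
        (hsub z (hz.2.trans hcb).le)).differentiableAt.differentiableWithinAt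
    · rw [interior_Icc]
      have key : AntitoneOn (fun z => m * twoLevelSlope m z) (Ioo 0 c) := by
        refine antitoneOn_of_hasDerivWithinAt_nonpos (convex_Ioo _ _)
          (fun z hz => ((hasDerivAt_twoLevelSlope hm hz.1
            (hsub z (hz.2.trans hcb).le)).const_mul m).continuousAt.continuousWithinAt)
          (fun z hz => ((hasDerivAt_twoLevelSlope hm (interior_subset hz).1
            (hsub z ((interior_subset hz).2.trans hcb).le)).const_mul m).hasDerivWithinAt) ?_
        intro z hz
        rw [interior_Ioo] at hz
        have h1 := hz.1
        have h2 := hsub z (hz.2.trans hcb).le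
        have h3 : 0 < 1 - z := by nlinarith
        refine mul_nonpos_of_nonneg_of_nonpos (by linarith)
          (div_nonpos_of_nonpos_of_nonneg ?_ (by positivity))
        nlinarith [hz.2]
      refine key.congr fun z hz => ?_
      exact (hasDerivAt_twoLevelGap hm hz.1 (hsub z (hz.2.trans hcb).le)).deriv.symm
  have hg0 : twoLevelGap m 0 = 0 := by simp [twoLevelGap, complGap_zero, complGap_one]
  have hc2 := hconc.2
  have := hc2 (left_mem_Icc.2 hc0.le) (right_mem_Icc.2 hc0.le)
    (a := 1 - x / c) (b := x / c) (sub_nonneg.2 ((div_le_one hc0).2 hxc.le))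
    (by positivity) (by ring)
  simp only [smul_eq_mul, hg0, mul_zero, zero_add, div_mul_cancel₀ _ hc0.ne'] at this
  exact (by positivity : 0 < x / c * twoLevelGap m c).trans_le this

/-! ### Reduction to two-level distributions -/

theorem ConvexOn.tangent_le {s : Set ℝ} {f : ℝ → ℝ} (hf : ConvexOn ℝ s f) {x z f' : ℝ}
    (hx : x ∈ s) (hz : z ∈ s) (h : HasDerivAt f f' x) : f x + f' * (z - x) ≤ f z := by
  rcases lt_trichotomy x z with hlt | rfl | hlt
  · have := hf.le_slope_of_hasDerivAt hx hz hlt h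
    rw [slope_def_field, le_div_iff₀ (by linarith)] at this
    linarith
  · simp
  · have := hf.slope_le_of_hasDerivAt hz hx hlt h
    rw [slope_def_field, div_le_iff₀ (by linarith)] at this
    linarith

/-- In the convex range this is the usual tangent bound. Beyond the inflection point s, the function
lies above its chord from s to 1 - m x, so it suffices to check the two ends of that chord. -/
theorem complGap_tangent_le {m : ℝ} (hm : 2 ≤ m) {x z : ℝ} (h0 : 0 < x) (hx : x ≤ 1 / (m + 1))
    (hz0 : 0 ≤ z) (hz : z ≤ 1 - m * x) :
    complGap m x + (log (1 - x) + 1 + complRatio m * (log x + 1)) * (z - x) ≤ complGap m z := by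
  have hγ := complRatio_pos hm
  have hγm := one_lt_mul_complRatio hm
  set s := complRatio m / (1 + complRatio m) with hs
  set D := log (1 - x) + 1 + complRatio m * (log x + 1)
  have hsb : 1 / (m + 1) ≤ s := by
    rw [hs, div_le_div_iff₀ (by linarith) (by linarith)]; linarith
  have hb0 : 0 < 1 / (m + 1) := by positivity
  have hb1 : 1 / (m + 1) < 1 := by rw [div_lt_one] <;> linarith
  have hbm : 1 / (m + 1) * (m + 1) = 1 := by field_simp
  have hD := hasDerivAt_complGap m h0.ne' (by linarith : 1 - x ≠ 0)
  have hconv := convexOn_complGap hm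
  have hxs : x ∈ Icc 0 s := ⟨h0.le, hx.trans hsb⟩
  by_cases hzs : z ≤ s
  · exact hconv.tangent_le hxs ⟨hz0, hzs⟩ hD
  push Not at hzs
  -- The tangent bound at the zero 1/(m+1) gives (m+1) φ(x) + D (1 - (m+1) x) ≤ 0 for φ = `complGap
  -- m`; combine with φ(1 - m x) ≥ -m φ(x), which is nonnegativity of `twoLevelGap`.
  have hy : complGap m x + D * (1 - m * x - x) ≤ complGap m (1 - m * x) := by
    have h1 := hconv.tangent_le hxs ⟨hb0.le, hsb⟩ hD
    rw [complGap_uniform hm] at h1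
    have h2 : 0 ≤ twoLevelGap m x := by
      rcases hx.lt_or_eq with h | h
      · exact (twoLevelGap_pos hm h0 h).le
      · have : 1 - m * x = x := by rw [h]; linarith
        rw [twoLevelGap, this, h, complGap_uniform hm]; simp
    rw [twoLevelGap] at h2
    have h3 := mul_le_mul_of_nonneg_left h1 (by linarith : 0 ≤ m + 1)
    have h4 : (m + 1) * (complGap m x + D * (1 / (m + 1) - x)) =
      (m + 1) * complGap m x + D * (1 / (m + 1) * (m + 1) - (m + 1) * x) := by ring
    rw [h4, hbm] at h3
    nlinarith
  have hss : complGap m x + D * (s - x) ≤ complGap m s :=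
    hconv.tangent_le hxs ⟨h0.le.trans hxs.2, le_rfl⟩ hD
  have hmx : 0 < m * x := by positivity
  have hs1 : s ≤ 1 := by linarith
  have hys : 0 < 1 - m * x - s := by linarith
  have hc2 := (concaveOn_complGap hm).2
  have := hc2 (x := s) (y := 1 - m * x) ⟨le_rfl, hs1⟩
    ⟨by linarith, by linarith⟩
    (a := (1 - m * x - z) / (1 - m * x - s)) (b := (z - s) / (1 - m * x - s))
    (div_nonneg (by linarith) hys.le) (div_nonneg (by linarith) hys.le)
    (by field_simp; ring)
  simp only [smul_eq_mul] at this
  have e : (1 - m * x - z) / (1 - m * x - s) * s + (z - s) / (1 - m * x - s) * (1 - m * x) = z := by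
    field_simp; ring
  rw [e] at this
  refine le_trans ?_ this
  have h1 := mul_le_mul_of_nonneg_left hss
    (div_nonneg (by linarith : 0 ≤ 1 - m * x - z) hys.le)
  have h2 := mul_le_mul_of_nonneg_left hy (div_nonneg (by linarith : 0 ≤ z - s) hys.le)
  refine le_trans (le_of_eq ?_) (add_le_add h1 h2)
  have e1 : (1 - m * x - z) / (1 - m * x - s) + (z - s) / (1 - m * x - s) = 1 := by
    field_simp; ring
  linear_combination (-D) * e + (D * x - complGap m x) * e1

/-- Among distributions on `m + 1 ≥ 3` points, `∑ η(1 - q) ≥ complRatio m * ∑ η(q)`, with equality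
only for point masses and the uniform distribution. -/
theorem sum_complGap_nonneg {β : Type*} [DecidableEq β] {B : Finset β} {m : ℝ}
    (hcard : (B.card : ℝ) = m + 1) (hm : 2 ≤ m) {q : β → ℝ} (hq : ∀ j ∈ B, 0 ≤ q j)
    (hsum : ∑ j ∈ B, q j = 1) :
    0 ≤ ∑ j ∈ B, complGap m (q j) ∧ (∑ j ∈ B, complGap m (q j) = 0 →
      (∃ j ∈ B, q j = 1) ∨ ∀ j ∈ B, q j = 1 / (m + 1)) := by
  have hne : B.Nonempty := by
    rw [← Finset.card_pos]
    have : (0 : ℝ) < B.card := by rw [hcard]; linarith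
    exact_mod_cast this
  obtain ⟨j₀, hj₀, hmax⟩ := B.exists_max_image q hne
  have hy1 : q j₀ ≤ 1 := hsum ▸ Finset.single_le_sum hq hj₀
  have hbm : 1 / (m + 1) * (m + 1) = 1 := by field_simp
  have hyb : 1 / (m + 1) ≤ q j₀ := by
    have := Finset.sum_le_card_nsmul B q _ hmax
    rw [hsum, nsmul_eq_mul, hcard] at this
    rw [div_le_iff₀ (by linarith)]; linarith
  have hrest : ∑ j ∈ B.erase j₀, q j = 1 - q j₀ := by
    rw [← Finset.add_sum_erase B q hj₀] at hsum; linarith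
  -- The mean of the non-maximal masses: the linear terms of the tangent at x cancel on summation.
  set x := (1 - q j₀) / m with hxdef
  have hmx : m * x = 1 - q j₀ := by rw [hxdef]; field_simp
  have hx0 : 0 ≤ x := div_nonneg (by linarith) (by linarith)
  have hxb : x ≤ 1 / (m + 1) := by
    rw [hxdef, div_le_iff₀ (by linarith)]; linarith
  rcases hx0.eq_or_lt with h | h
  · have hy : q j₀ = 1 := by rw [← h] at hmx; linarith
    refine ⟨le_of_eq ?_, fun _ => Or.inl ⟨j₀, hj₀, hy⟩⟩
    symm
    rw [← Finset.add_sum_erase B _ hj₀, hy, complGap_one, zero_add]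
    refine Finset.sum_eq_zero fun j hj => ?_
    have := (Finset.sum_eq_zero_iff_of_nonneg
      (fun j hj => hq j (Finset.mem_of_mem_erase hj))).1 (by rw [hrest, hy]; ring) j hj
    rw [this, complGap_zero]
  have hge : twoLevelGap m x ≤ ∑ j ∈ B, complGap m (q j) := by
    rw [← Finset.add_sum_erase B _ hj₀, twoLevelGap, add_comm]
    have : 1 - m * x = q j₀ := by linarith
    rw [this]
    have hle := Finset.sum_le_sum (s := B.erase j₀) fun j hj =>
      complGap_tangent_le hm h hxb (hq j (Finset.mem_of_mem_erase hj))
        (this ▸ hmax j (Finset.mem_of_mem_erase hj))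
    rw [Finset.sum_add_distrib, ← Finset.mul_sum, Finset.sum_sub_distrib, hrest,
      Finset.sum_const, Finset.sum_const, Finset.card_erase_of_mem hj₀, nsmul_eq_mul, nsmul_eq_mul,
      Nat.cast_pred hne.card_pos, hcard, add_sub_cancel_right, hmx] at hle
    linarith
  rcases hxb.lt_or_eq with hlt | heq
  · have := twoLevelGap_pos hm h hlt
    exact ⟨by linarith, fun h => by linarith⟩
  · have hy : q j₀ = 1 / (m + 1) := by rw [heq] at hmx; linarith
    have hall : ∀ j ∈ B, q j = 1 / (m + 1) := by
      refine (Finset.sum_eq_sum_iff_of_le fun j hj => hy ▸ hmax j hj).1 ?_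
      rw [hsum, Finset.sum_const, nsmul_eq_mul, hcard]; linarith
    refine ⟨le_of_eq ?_, fun _ => Or.inr hall⟩
    symm
    exact Finset.sum_eq_zero fun j hj => by rw [hall j hj, complGap_uniform hm]

/-! ### Homogeneous entropy and its superadditivity -/

/-- The entropy of a finite measure with masses `v b`, `b ∈ s`, extended homogeneously from
probability measures. -/
noncomputable def massEntropy {β : Type*} (s : Finset β) (v : β → ℝ) : ℝ :=
  ∑ b ∈ s, negMulLog (v b) - negMulLog (∑ b ∈ s, v b)

theorem massEntropy_congr {β : Type*} {s : Finset β} {u v : β → ℝ} (h : ∀ b ∈ s, u b = v b) :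
    massEntropy s u = massEntropy s v := by
  rw [massEntropy, massEntropy, Finset.sum_congr rfl h,
    Finset.sum_congr rfl fun b hb => congrArg negMulLog (h b hb)]

theorem massEntropy_zero {β : Type*} (s : Finset β) : massEntropy s (fun _ => 0) = 0 := by
  simp [massEntropy]

theorem massEntropy_eq_sum {β : Type*} (s : Finset β) (v : β → ℝ) :
    massEntropy s v = ∑ b ∈ s, (negMulLog (v b) + v b * log (∑ b ∈ s, v b)) := by
  rw [massEntropy, Finset.sum_add_distrib, ← Finset.sum_mul, negMulLog]
  ring

theorem massEntropy_smul {β : Type*} (s : Finset β) (v : β → ℝ) (c : ℝ) :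
    massEntropy s (fun b => c * v b) = c * massEntropy s v := by
  simp only [massEntropy, negMulLog_mul, ← Finset.mul_sum, Finset.sum_add_distrib,
    ← Finset.sum_mul]
  ring

theorem negMulLog_add_mul_log {a A : ℝ} (hA : 0 < A) :
    negMulLog a + a * log A = A * negMulLog (a / A) := by
  rcases eq_or_ne a 0 with rfl | ha
  · simp
  · rw [negMulLog, negMulLog, log_div ha hA.ne']
    field_simp
    ring

/-- Each term is the perspective A η(a/A) of the concave η, and perspectives of concave functions
are superadditive. -/
theorem log_sum_inequality {a b A B : ℝ} (ha : 0 ≤ a) (hb : 0 ≤ b) (haA : a ≤ A) (hbB : b ≤ B) :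
    negMulLog a + a * log A + (negMulLog b + b * log B) ≤
      negMulLog (a + b) + (a + b) * log (A + B) := by
  rcases (ha.trans haA).eq_or_lt with rfl | hA
  · simp [le_antisymm haA ha]
  rcases (hb.trans hbB).eq_or_lt with rfl | hB
  · simp [le_antisymm hbB hb]
  rw [negMulLog_add_mul_log hA, negMulLog_add_mul_log hB, negMulLog_add_mul_log (add_pos hA hB)]
  have hAB : 0 < A + B := add_pos hA hB
  have hc := concaveOn_negMulLog.2
  have := hc (x := a / A) (mem_Ici.2 (by positivity)) (y := b / B) (mem_Ici.2 (by positivity))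
    (a := A / (A + B)) (b := B / (A + B)) (by positivity) (by positivity) (by field_simp)
  simp only [smul_eq_mul] at this
  have e : A / (A + B) * (a / A) + B / (A + B) * (b / B) = (a + b) / (A + B) := by field_simp
  rw [e] at this
  have h2 := mul_le_mul_of_nonneg_left this hAB.le
  refine le_trans (le_of_eq ?_) h2
  field_simp

theorem massEntropy_add_le {β : Type*} {s : Finset β} {u v : β → ℝ} (hu : ∀ b ∈ s, 0 ≤ u b)
    (hv : ∀ b ∈ s, 0 ≤ v b) :
    massEntropy s u + massEntropy s v ≤ massEntropy s (fun b => u b + v b) := by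
  rw [massEntropy_eq_sum, massEntropy_eq_sum, massEntropy_eq_sum, ← Finset.sum_add_distrib,
    Finset.sum_add_distrib (f := u)]
  exact Finset.sum_le_sum fun b hb => log_sum_inequality (hu b hb) (hv b hb)
    (Finset.single_le_sum hu hb) (Finset.single_le_sum hv hb)

theorem sum_massEntropy_le {ι β : Type*} [DecidableEq ι] {s : Finset β} (R : Finset ι)
    {v : ι → β → ℝ} (hv : ∀ r ∈ R, ∀ b ∈ s, 0 ≤ v r b) :
    ∑ r ∈ R, massEntropy s (v r) ≤ massEntropy s (fun b => ∑ r ∈ R, v r b) := by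
  induction R using Finset.induction_on with
  | empty => simp [massEntropy_zero]
  | insert r R hr ih =>
    simp only [Finset.sum_insert hr]
    refine (add_le_add_right (ih fun r hr => hv r (Finset.mem_insert_of_mem hr)) _).trans ?_
    exact massEntropy_add_le (hv r (Finset.mem_insert_self _ _)) fun b hb =>
      Finset.sum_nonneg fun i hi => hv i (Finset.mem_insert_of_mem hi) b hb

/-! ### The critical rate and the one-distribution inequality -/

/-- The reciprocal of the critical exponent: `n! / n ^ (n / p) = 1` at `1 / p = critRate n`. -/
noncomputable def critRate (n : ℕ) : ℝ := log (n.factorial : ℝ) / (n * log n)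

theorem critRate_nonneg (n : ℕ) : 0 ≤ critRate n :=
  div_nonneg (log_natCast_nonneg _) (mul_nonneg n.cast_nonneg (log_natCast_nonneg _))

theorem critRate_pos {n : ℕ} (hn : 2 ≤ n) : 0 < critRate n := by
  have h2 : (2 : ℝ) ≤ n := by exact_mod_cast hn
  refine div_pos (log_pos ?_) (mul_pos (by linarith) (log_pos (by linarith)))
  exact_mod_cast (show 1 < n.factorial from lt_of_lt_of_le (by omega) (Nat.self_le_factorial n))

theorem critRate_mul {n : ℕ} : critRate n * (n * log n) = log (n.factorial : ℝ) := by
  rcases Nat.lt_or_ge n 2 with h | h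
  · interval_cases n <;> simp
  · have h2 : (2 : ℝ) ≤ n := by exact_mod_cast h
    exact div_mul_cancel₀ _ (mul_pos (by linarith) (log_pos (by linarith))).ne'

/-- The recursion that closes the induction without loss. It fails to make sense below m = 2, where
log m vanishes. -/
theorem critRate_succ {m : ℕ} (hm : 2 ≤ m) :
    (m + 1 : ℕ) * critRate (m + 1) = 1 + critRate m * (m - complRatio m) := by
  have h2 : (2 : ℝ) ≤ m := by exact_mod_cast hm
  have h3 : 0 < log m := log_pos (by linarith)
  have h4 : 0 < log ((m : ℝ) + 1) := log_pos (by linarith)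
  have h5 : log ((m + 1).factorial : ℝ) = log (m + 1) + log (m.factorial : ℝ) := by
    rw [Nat.factorial_succ, Nat.cast_mul, log_mul (by positivity) (by positivity)]; push_cast; rfl
  rw [critRate, critRate, complRatio, h5, log_div (by linarith) (by linarith)]
  push_cast
  field_simp
  ring

/-- `v` is concentrated on one point of `s`, or constant on `s`. -/
def IsPointOrUniform {β : Type*} (s : Finset β) (v : β → ℝ) : Prop :=
  (∃ j ∈ s, ∀ l ∈ s, l ≠ j → v l = 0) ∨ ∃ c, ∀ j ∈ s, v j = c

theorem sum_massEntropy_erase {β : Type*} [DecidableEq β] (B : Finset β) (v : β → ℝ) :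
    ∑ b ∈ B, massEntropy (B.erase b) v =
      (B.card - 1) * ∑ b ∈ B, negMulLog (v b) - ∑ b ∈ B, negMulLog (∑ l ∈ B, v l - v b) := by
  have h : ∀ b ∈ B, massEntropy (B.erase b) v =
      ∑ l ∈ B, negMulLog (v l) - negMulLog (v b) - negMulLog (∑ l ∈ B, v l - v b) := by
    intro b hb
    rw [massEntropy, ← Finset.add_sum_erase B _ hb, ← Finset.add_sum_erase B v hb,
      add_sub_cancel_left, add_sub_cancel_left]
  rw [Finset.sum_congr rfl h, Finset.sum_sub_distrib, Finset.sum_sub_distrib, Finset.sum_const,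
    nsmul_eq_mul]
  ring

theorem sum_massEntropy_erase_le {β : Type*} [DecidableEq β] {B : Finset β} {m : ℕ}
    (hcard : B.card = m + 1) (hm : 2 ≤ m) {v : β → ℝ} (hv : ∀ b ∈ B, 0 ≤ v b) :
    ∑ b ∈ B, massEntropy (B.erase b) v ≤ (m - complRatio m) * massEntropy B v ∧
      (∑ b ∈ B, massEntropy (B.erase b) v = (m - complRatio m) * massEntropy B v →
        IsPointOrUniform B v) := by
  rcases (Finset.sum_nonneg hv).eq_or_lt with h0 | hV
  · have hz := (Finset.sum_eq_zero_iff_of_nonneg hv).1 h0.symm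
    have e : massEntropy B v = 0 := (massEntropy_congr hz).trans (massEntropy_zero B)
    have e' : ∀ b ∈ B, massEntropy (B.erase b) v = 0 := fun b _ =>
      (massEntropy_congr fun l hl => hz l (Finset.mem_of_mem_erase hl)).trans (massEntropy_zero _)
    rw [e, Finset.sum_eq_zero e']
    exact ⟨by simp, fun _ => Or.inr ⟨0, hz⟩⟩
  set V := ∑ b ∈ B, v b with hVdef
  set q : β → ℝ := fun b => v b / V with hq
  have hvq : v = fun b => V * q b := by
    funext b; rw [hq]; field_simp
  have hq1 : ∑ b ∈ B, q b = 1 := by rw [hq, ← Finset.sum_div, div_self hV.ne']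
  have hq0 : ∀ b ∈ B, 0 ≤ q b := fun b hb => div_nonneg (hv b hb) hV.le
  obtain ⟨h1, h2⟩ := sum_complGap_nonneg (m := (m : ℝ)) (by rw [hcard]; push_cast; rfl)
    (by exact_mod_cast hm) hq0 hq1
  have key : (m - complRatio m) * massEntropy B v - ∑ b ∈ B, massEntropy (B.erase b) v =
      V * ∑ b ∈ B, complGap m (q b) := by
    rw [hvq]
    simp only [massEntropy_smul, ← Finset.mul_sum]
    rw [sum_massEntropy_erase, massEntropy, hq1, hcard]
    simp only [complGap, Finset.sum_sub_distrib, ← Finset.mul_sum, negMulLog_one]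
    push_cast
    ring
  have h3 := mul_nonneg hV.le h1
  refine ⟨by linarith, fun h => ?_⟩
  have h4 : ∑ b ∈ B, complGap m (q b) = 0 := by
    rw [h, sub_self, eq_comm, mul_eq_zero] at key
    exact key.resolve_left hV.ne'
  rcases h2 h4 with ⟨j, hj, hj1⟩ | hu
  · refine Or.inl ⟨j, hj, fun l hl hlj => ?_⟩
    rw [← Finset.add_sum_erase B q hj, hj1] at hq1
    have := (Finset.sum_eq_zero_iff_of_nonneg (fun b hb => hq0 b (Finset.mem_of_mem_erase hb))).1
      (by linarith) l (Finset.mem_erase.2 ⟨hlj, hl⟩)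
    rw [hvq]; simp [this]
  · refine Or.inr ⟨V * (1 / (m + 1)), fun j hj => ?_⟩
    rw [hvq]; simp only [hu j hj]

theorem massEntropy_singleton {β : Type*} (b : β) (v : β → ℝ) : massEntropy {b} v = 0 := by
  simp [massEntropy]

theorem massEntropy_add_erase_le {β : Type*} [DecidableEq β] {B : Finset β} {m : ℕ}
    (hcard : B.card = m + 1) {v : β → ℝ} (hv : ∀ b ∈ B, 0 ≤ v b) :
    massEntropy B v + critRate m * ∑ b ∈ B, massEntropy (B.erase b) v ≤
        (m + 1 : ℕ) * critRate (m + 1) * massEntropy B v ∧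
      (2 ≤ m → massEntropy B v + critRate m * ∑ b ∈ B, massEntropy (B.erase b) v =
        (m + 1 : ℕ) * critRate (m + 1) * massEntropy B v → IsPointOrUniform B v) := by
  -- For m < 2 both sides agree for every v, since `critRate 1 = 0` and `2 * critRate 2 = 1`; no
  -- rigidity is available.
  rcases Nat.lt_or_ge m 2 with h | h
  · refine ⟨?_, fun h' => absurd h' (by omega)⟩
    interval_cases m
    · obtain ⟨b, rfl⟩ := Finset.card_eq_one.1 hcard
      simp [massEntropy_singleton, critRate]
    · have : (2 : ℝ) * (log 2 / (2 * log 2)) = 1 := by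
        have := (log_pos (by norm_num : (1 : ℝ) < 2)).ne'
        field_simp
      simp [critRate, this]
  · obtain ⟨h1, h2⟩ := sum_massEntropy_erase_le hcard h hv
    have hd := critRate_pos h
    rw [critRate_succ h]
    refine ⟨by nlinarith, fun _ h3 => h2 ?_⟩
    refine mul_left_cancel₀ hd.ne' ?_
    linear_combination h3

/-! ### Entropy of random injections -/

section Marginals

variable {Ω ι β : Type*} [DecidableEq ι] [DecidableEq β]

/-- The part of the weight `w` where `X` takes the value `b`. -/
def condWeight (w : Ω → ℝ) (X : Ω → β) (b : β) (ω : Ω) : ℝ := if X ω = b then w ω else 0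

theorem condWeight_nonneg {w : Ω → ℝ} (hw : ∀ ω, 0 ≤ w ω) (X : Ω → β) (b : β) (ω : Ω) :
    0 ≤ condWeight w X b ω := by
  unfold condWeight; split_ifs <;> simp [hw]

/-- The family `X` restricted to `S` is, on the support of `w`, a family of injections from `S`
into `B`, which determine the point of `Ω`. -/
structure IsInjFamily (w : Ω → ℝ) (X : ι → Ω → β) (S : Finset ι) (B : Finset β) : Prop where
  nonneg : ∀ ω, 0 ≤ w ω
  mem : ∀ ω, w ω ≠ 0 → ∀ i ∈ S, X i ω ∈ B
  inj : ∀ ω, w ω ≠ 0 → ∀ i ∈ S, ∀ j ∈ S, X i ω = X j ω → i = j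
  ext : ∀ ω ω', w ω ≠ 0 → w ω' ≠ 0 → (∀ i ∈ S, X i ω = X i ω') → ω = ω'

/-- Conditioning is restriction without renormalising, which suits the homogeneous entropy. The
coordinate r is constant on the new support, so the others still determine ω. -/
theorem IsInjFamily.condWeight {w : Ω → ℝ} {X : ι → Ω → β} {S : Finset ι} {B : Finset β}
    (h : IsInjFamily w X S B) {r : ι} (hr : r ∈ S) (b : β) :
    IsInjFamily (condWeight w (X r) b) X (S.erase r) (B.erase b) := by
  have h0 : ∀ ω, _root_.condWeight w (X r) b ω ≠ 0 → X r ω = b ∧ w ω ≠ 0 := by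
    intro ω hω
    unfold _root_.condWeight at hω
    split_ifs at hω with h1
    · exact ⟨h1, hω⟩
    · exact absurd rfl hω
  refine ⟨condWeight_nonneg h.nonneg _ _, fun ω hω i hi => ?_, fun ω hω i hi j hj hij => ?_,
    fun ω ω' hω hω' hx => ?_⟩
  · obtain ⟨h1, h2⟩ := h0 ω hω
    have hi' := Finset.mem_erase.1 hi
    exact Finset.mem_erase.2 ⟨fun e => hi'.1 (h.inj ω h2 i hi'.2 r hr (e.trans h1.symm)),
      h.mem ω h2 i hi'.2⟩
  · exact h.inj ω (h0 ω hω).2 i (Finset.mem_of_mem_erase hi) j (Finset.mem_of_mem_erase hj) hij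
  · refine h.ext ω ω' (h0 ω hω).2 (h0 ω' hω').2 fun i hi => ?_
    by_cases hir : i = r
    · rw [hir, (h0 ω hω).1, (h0 ω' hω').1]
    · exact hx i (Finset.mem_erase.2 ⟨hir, hi⟩)

variable [Fintype Ω]

/-- The masses of the image of the weight `w` under `X`. -/
def marginal (w : Ω → ℝ) (X : Ω → β) (b : β) : ℝ := ∑ ω, condWeight w X b ω

theorem marginal_nonneg {w : Ω → ℝ} (hw : ∀ ω, 0 ≤ w ω) (X : Ω → β) (b : β) :
    0 ≤ marginal w X b := Finset.sum_nonneg fun ω _ => condWeight_nonneg hw X b ω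

theorem sum_comp_condWeight {w : Ω → ℝ} {X : Ω → β} {B : Finset β}
    (h : ∀ ω, w ω ≠ 0 → X ω ∈ B) {f : ℝ → ℝ} (hf : f 0 = 0) :
    ∑ b ∈ B, ∑ ω, f (condWeight w X b ω) = ∑ ω, f (w ω) := by
  rw [Finset.sum_comm]
  refine Finset.sum_congr rfl fun ω _ => ?_
  simp only [condWeight, apply_ite f, hf, Finset.sum_ite_eq]
  split_ifs with h1
  · rfl
  · rw [not_imp_comm.1 (h ω) h1, hf]

/-- The chain rule; homogeneity builds the probability of X = b into each conditional term. -/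
theorem massEntropy_univ_eq {w : Ω → ℝ} {X : Ω → β} {B : Finset β}
    (h : ∀ ω, w ω ≠ 0 → X ω ∈ B) :
    massEntropy Finset.univ w = massEntropy B (marginal w X) +
      ∑ b ∈ B, massEntropy Finset.univ (condWeight w X b) := by
  have h1 := sum_comp_condWeight h negMulLog_zero
  have h2 := sum_comp_condWeight h (f := id) rfl
  simp only [massEntropy, marginal, Finset.sum_sub_distrib, h1]
  simp only [id] at h2
  rw [h2]
  ring

/-- Equal cardinalities make the injection onto, so exactly one r takes the value b, and r ≠ i
because X i = l ≠ b. -/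
theorem IsInjFamily.sum_marginal {w : Ω → ℝ} {X : ι → Ω → β} {S : Finset ι} {B : Finset β}
    (h : IsInjFamily w X S B) (hcard : S.card = B.card) {i : ι} {b l : β} (hb : b ∈ B)
    (hl : l ≠ b) (hi : i ∈ S) :
    ∑ r ∈ S.erase i, marginal (_root_.condWeight w (X r) b) (X i) l = marginal w (X i) l := by
  simp only [marginal]
  rw [Finset.sum_comm]
  refine Finset.sum_congr rfl fun ω _ => ?_
  by_cases hω : w ω = 0
  · simp [_root_.condWeight, hω]
  by_cases hil : X i ω = l
  swap
  · simp [_root_.condWeight, hil]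
  simp only [_root_.condWeight, hil, if_true]
  obtain ⟨r, hr, hrb⟩ := Finset.surj_on_of_inj_on_of_card_le (fun r _ => X r ω)
    (fun r hr => h.mem ω hω r hr) (fun r r' hr hr' e => h.inj ω hω r hr r' hr' e) hcard.ge b hb
  have hri : r ≠ i := by rintro rfl; exact hl (hil.symm.trans hrb.symm)
  rw [Finset.sum_eq_single r]
  · simp [hrb.symm]
  · intro r' hr' hne
    rw [if_neg]
    intro e
    exact hne (h.inj ω hω r' (Finset.mem_of_mem_erase hr') r hr (e.trans hrb))
  · intro hn; exact absurd (Finset.mem_erase.2 ⟨hri, hr⟩) hn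

theorem massEntropy_le_of_card_succ {X : ι → Ω → β} {m : ℕ}
    (ih : ∀ (w : Ω → ℝ) (S : Finset ι) (B : Finset β), IsInjFamily w X S B → S.card = m →
      B.card = m → massEntropy Finset.univ w ≤
        critRate m * ∑ i ∈ S, massEntropy B (marginal w (X i)))
    {w : Ω → ℝ} {S : Finset ι} {B : Finset β} (h : IsInjFamily w X S B) (hS : S.card = m + 1)
    (hB : B.card = m + 1) :
    (m + 1 : ℕ) * massEntropy Finset.univ w ≤ ∑ i ∈ S, (massEntropy B (marginal w (X i)) +
      critRate m * ∑ b ∈ B, massEntropy (B.erase b) (marginal w (X i))) := by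
  have h1 : ∀ r ∈ S, massEntropy Finset.univ w ≤ massEntropy B (marginal w (X r)) +
      critRate m * ∑ b ∈ B, ∑ i ∈ S.erase r,
        massEntropy (B.erase b) (marginal (condWeight w (X r) b) (X i)) := by
    intro r hr
    rw [massEntropy_univ_eq (fun ω hω => h.mem ω hω r hr), Finset.mul_sum]
    gcongr with b hb
    exact ih _ _ _ (h.condWeight hr b) (by rw [Finset.card_erase_of_mem hr, hS]; rfl)
      (by rw [Finset.card_erase_of_mem hb, hB]; rfl)
  have h2 := Finset.sum_le_sum h1
  rw [Finset.sum_const, hS, nsmul_eq_mul, Finset.sum_add_distrib, ← Finset.mul_sum] at h2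
  refine h2.trans ?_
  rw [Finset.sum_add_distrib, ← Finset.mul_sum]
  refine add_le_add le_rfl (mul_le_mul_of_nonneg_left ?_ (critRate_nonneg m))
  rw [Finset.sum_comm, Finset.sum_comm (s := S)]
  refine Finset.sum_le_sum fun b hb => ?_
  -- Regroup by i, so that superadditivity over r merges the conditional laws of X i.
  rw [Finset.sum_comm' (t' := S) (s' := fun i => S.erase i)
    (by intro x y; simp only [Finset.mem_erase]; tauto)]
  refine Finset.sum_le_sum fun i hi => ?_
  refine (sum_massEntropy_le _ fun r _ l _ =>
    marginal_nonneg (condWeight_nonneg h.nonneg _ _) _ _).trans (le_of_eq ?_)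
  exact massEntropy_congr fun l hl =>
    h.sum_marginal (hS.trans hB.symm) hb (Finset.ne_of_mem_erase hl) hi

theorem massEntropy_le_critRate {X : ι → Ω → β} (m : ℕ) :
    ∀ (w : Ω → ℝ) (S : Finset ι) (B : Finset β), IsInjFamily w X S B → S.card = m →
      B.card = m → massEntropy Finset.univ w ≤
        critRate m * ∑ i ∈ S, massEntropy B (marginal w (X i)) := by
  induction m with
  | zero =>
    intro w S B h hS hB
    rw [Finset.card_eq_zero.1 hS, Finset.sum_empty, mul_zero]
    -- With S empty, `ext` leaves at most one point in the support.
    by_cases hw : ∃ ω, w ω ≠ 0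
    · obtain ⟨ω, hω⟩ := hw
      have h0 : ∀ ω', ω' ≠ ω → w ω' = 0 := fun ω' hne => by
        by_contra h'
        exact hne (h.ext ω' ω h' hω (by simp [Finset.card_eq_zero.1 hS]))
      rw [massEntropy, Finset.sum_eq_single ω (fun b _ hb => by rw [h0 b hb, negMulLog_zero])
        (by simp), Finset.sum_eq_single ω (fun b _ hb => h0 b hb) (by simp), sub_self]
    · push Not at hw
      rw [massEntropy_congr (fun ω _ => hw ω), massEntropy_zero]
  | succ m ih =>
    intro w S B h hS hB
    have h1 := massEntropy_le_of_card_succ ih h hS hB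
    have h2 := h1.trans (Finset.sum_le_sum fun i _ =>
      (massEntropy_add_erase_le hB (fun b _ => marginal_nonneg h.nonneg (X i) b)).1)
    rw [← Finset.mul_sum, mul_assoc] at h2
    exact le_of_mul_le_mul_left h2 (by positivity)

theorem isPointOrUniform_of_massEntropy_eq {X : ι → Ω → β} {m : ℕ} {w : Ω → ℝ} {S : Finset ι}
    {B : Finset β} (h : IsInjFamily w X S B) (hS : S.card = m) (hB : B.card = m) (hm : 3 ≤ m)
    (heq : massEntropy Finset.univ w = critRate m * ∑ i ∈ S, massEntropy B (marginal w (X i))) :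
    ∀ i ∈ S, IsPointOrUniform B (marginal w (X i)) := by
  obtain ⟨m, rfl⟩ : ∃ k, m = k + 1 := ⟨m - 1, by omega⟩
  have h1 := massEntropy_le_of_card_succ (massEntropy_le_critRate m) h hS hB
  rw [heq, ← mul_assoc, Finset.mul_sum] at h1
  have h2 := fun i (_ : i ∈ S) =>
    massEntropy_add_erase_le hB (fun b _ => marginal_nonneg h.nonneg (X i) b)
  have h3 := (Finset.sum_eq_sum_iff_of_le fun i hi => (h2 i hi).1).1
    (le_antisymm (Finset.sum_le_sum fun i hi => (h2 i hi).1) h1)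
  exact fun i hi => (h2 i hi).2 (by omega) (h3 i hi)

end Marginals

/-! ### Gibbs' inequality and the range of entropy -/

/-- This is log t ≤ t - 1 at t = s/(T q). The slack s/T - q sums to zero in Gibbs' inequality. -/
theorem negMulLog_add_mul_log_le {q s T : ℝ} (hq : 0 ≤ q) (hs : 0 ≤ s) (hT : 0 < T)
    (hqs : q ≠ 0 → s ≠ 0) :
    negMulLog q + q * log s ≤ q * log T + (s / T - q) ∧
      (negMulLog q + q * log s = q * log T + (s / T - q) → q = s / T) := by
  rcases hq.eq_or_lt with rfl | hq
  · simp only [negMulLog_zero, zero_mul, zero_add, sub_zero]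
    exact ⟨by positivity, id⟩
  have hs' : 0 < s := lt_of_le_of_ne hs (hqs hq.ne').symm
  have e : negMulLog q + q * log s = q * log T + q * log (s / T / q) := by
    rw [negMulLog, log_div (by positivity) hq.ne', log_div hs'.ne' hT.ne']; ring
  have e2 : s / T - q = q * (s / T / q - 1) := by field_simp
  have hpos : 0 < s / T / q := by positivity
  rw [e, e2]
  refine ⟨?_, fun h => ?_⟩
  · gcongr
    exact log_le_sub_one_of_pos hpos
  · by_contra hne
    have h1 : s / T / q ≠ 1 := fun h1 => hne ((div_eq_one_iff_eq hq.ne').1 h1).symm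
    have := mul_lt_mul_of_pos_left (log_lt_sub_one_of_pos hpos h1) hq
    linarith

theorem gibbs_inequality {β : Type*} {s : Finset β} {q v : β → ℝ} (hq : ∀ j ∈ s, 0 ≤ q j)
    (hsum : ∑ j ∈ s, q j = 1) (hv : ∀ j ∈ s, 0 ≤ v j) (hqv : ∀ j ∈ s, q j ≠ 0 → v j ≠ 0) :
    massEntropy s q + ∑ j ∈ s, q j * log (v j) ≤ log (∑ j ∈ s, v j) ∧
      (massEntropy s q + ∑ j ∈ s, q j * log (v j) = log (∑ j ∈ s, v j) →
        ∀ j ∈ s, q j = v j / ∑ j ∈ s, v j) := by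
  have hT : 0 < ∑ j ∈ s, v j := by
    obtain ⟨j, hj, hj0⟩ := Finset.exists_ne_zero_of_sum_ne_zero (hsum.trans_ne one_ne_zero)
    exact Finset.sum_pos' hv ⟨j, hj, lt_of_le_of_ne (hv j hj) (hqv j hj hj0).symm⟩
  have h := fun j hj => negMulLog_add_mul_log_le (hq j hj) (hv j hj) hT (hqv j hj)
  have e1 : massEntropy s q + ∑ j ∈ s, q j * log (v j) =
      ∑ j ∈ s, (negMulLog (q j) + q j * log (v j)) := by
    rw [massEntropy, hsum, negMulLog_one, sub_zero, Finset.sum_add_distrib]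
  have e2 : log (∑ j ∈ s, v j) =
      ∑ j ∈ s, (q j * log (∑ j ∈ s, v j) + (v j / ∑ j ∈ s, v j - q j)) := by
    rw [Finset.sum_add_distrib, ← Finset.sum_mul, Finset.sum_sub_distrib, ← Finset.sum_div, hsum,
      div_self hT.ne']
    ring
  rw [e1]
  refine ⟨?_, fun he j hj => ?_⟩
  · rw [e2]; exact Finset.sum_le_sum fun j hj => (h j hj).1
  · rw [e2] at he
    exact (h j hj).2 ((Finset.sum_eq_sum_iff_of_le fun j hj => (h j hj).1).1 he j hj)

theorem massEntropy_le_log_card {β : Type*} {s : Finset β} {q : β → ℝ} (hq : ∀ j ∈ s, 0 ≤ q j)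
    (hsum : ∑ j ∈ s, q j = 1) :
    massEntropy s q ≤ log s.card ∧ (massEntropy s q = log s.card →
      ∀ j ∈ s, q j = 1 / s.card) := by
  simpa using gibbs_inequality hq hsum (v := fun _ => 1) (by simp) (by simp)

theorem massEntropy_nonneg {β : Type*} {s : Finset β} {q : β → ℝ} (hq : ∀ j ∈ s, 0 ≤ q j)
    (hsum : ∑ j ∈ s, q j = 1) :
    0 ≤ massEntropy s q ∧ (massEntropy s q = 0 → ∃ j ∈ s, ∀ l ∈ s, l ≠ j → q l = 0) := by
  classical
  have h1 : ∀ j ∈ s, 0 ≤ negMulLog (q j) := fun j hj =>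
    negMulLog_nonneg (hq j hj) (hsum ▸ Finset.single_le_sum hq hj)
  rw [massEntropy, hsum, negMulLog_one, sub_zero]
  refine ⟨Finset.sum_nonneg h1, fun h0 => ?_⟩
  have h2 := (Finset.sum_eq_zero_iff_of_nonneg h1).1 h0
  obtain ⟨j, hj, hj0⟩ := Finset.exists_ne_zero_of_sum_ne_zero (hsum.trans_ne one_ne_zero)
  have hj1 : q j = 1 := by
    have h3 := h2 j hj
    rw [negMulLog, mul_eq_zero, neg_eq_zero, or_iff_right hj0, log_eq_zero] at h3
    rcases h3 with h | h | h
    · exact absurd h hj0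
    · exact h
    · linarith [hq j hj]
  refine ⟨j, hj, fun l hl hlj => ?_⟩
  rw [← Finset.add_sum_erase s q hj, hj1] at hsum
  exact (Finset.sum_eq_zero_iff_of_nonneg fun b hb => hq b (Finset.mem_of_mem_erase hb)).1
    (by linarith) l (Finset.mem_erase.2 ⟨hlj, hl⟩)

/-! ### The constant and the row norms -/

/-- The ratio of the permanent of the all-ones matrix to the product of the `ℓ_p` norms of its
rows. -/
noncomputable def onesRatio (n : ℕ) (p : ℝ) : ℝ := (n.factorial : ℝ) / (n : ℝ) ^ ((n : ℝ) / p)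

theorem natCast_rpow_pos (n : ℕ) (p : ℝ) : 0 < (n : ℝ) ^ ((n : ℝ) / p) := by
  rcases Nat.eq_zero_or_pos n with rfl | h
  · simp
  · exact rpow_pos_of_pos (by exact_mod_cast h) _

theorem onesRatio_pos (n : ℕ) (p : ℝ) : 0 < onesRatio n p :=
  div_pos (by positivity) (natCast_rpow_pos n p)

theorem log_onesRatio (n : ℕ) (p : ℝ) :
    log (onesRatio n p) = n * ((critRate n - 1 / p) * log n) := by
  rw [onesRatio, log_div (by positivity) (natCast_rpow_pos n p).ne', ← critRate_mul]
  rcases Nat.eq_zero_or_pos n with rfl | h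
  · simp
  · rw [log_rpow (by exact_mod_cast h)]; ring

theorem log_max_onesRatio (n : ℕ) (p : ℝ) :
    log (max 1 (onesRatio n p)) = n * max 0 ((critRate n - 1 / p) * log n) := by
  rw [mul_max_of_nonneg _ _ n.cast_nonneg, mul_zero, ← log_onesRatio]
  rcases le_total 1 (onesRatio n p) with h | h
  · rw [max_eq_right h, max_eq_right (log_nonneg h)]
  · rw [max_eq_left h, max_eq_left (log_nonpos (onesRatio_pos n p).le h), log_one]

theorem norm_toLp_of_nonneg {n : ℕ} {p : ℝ} (hp : 1 ≤ p) {a : Fin n → ℝ} (ha : ∀ j, 0 ≤ a j) :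
    ‖WithLp.toLp (ENNReal.ofReal p) a‖ = (∑ j, a j ^ p) ^ (1 / p) := by
  have h : (ENNReal.ofReal p).toReal = p := ENNReal.toReal_ofReal (by linarith)
  rw [PiLp.norm_eq_sum (by rw [h]; linarith), h]
  simp [abs_of_nonneg (ha _)]

/-! ### The random permutation and the upper bound -/

section Permanent

variable {n : ℕ} {p : ℝ} {A : Matrix (Fin n) (Fin n) ℝ}

theorem permanent_eq_sum_rows (A : Matrix (Fin n) (Fin n) ℝ) :
    A.permanent = ∑ σ : Equiv.Perm (Fin n), ∏ i, A i (σ i) := by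
  rw [← Matrix.permanent_transpose]; rfl

/-- The probability of `σ` proportional to its term in the permanent of `A`. -/
noncomputable def permWeight (A : Matrix (Fin n) (Fin n) ℝ) (σ : Equiv.Perm (Fin n)) : ℝ :=
  (∏ i, A i (σ i)) / A.permanent

/-- The distribution of `σ i` when `σ` is distributed according to `permWeight A`. -/
noncomputable def permMarginal (A : Matrix (Fin n) (Fin n) ℝ) (i : Fin n) : Fin n → ℝ :=
  marginal (permWeight A) (fun σ => σ i)

theorem permanent_nonneg (hA : ∀ i j, 0 ≤ A i j) : 0 ≤ A.permanent := by
  rw [permanent_eq_sum_rows]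
  exact Finset.sum_nonneg fun σ _ => Finset.prod_nonneg fun i _ => hA i _

theorem permWeight_nonneg (hA : ∀ i j, 0 ≤ A i j) (σ : Equiv.Perm (Fin n)) :
    0 ≤ permWeight A σ :=
  div_nonneg (Finset.prod_nonneg fun i _ => hA i _) (permanent_nonneg hA)

theorem sum_permWeight (h : 0 < A.permanent) : ∑ σ, permWeight A σ = 1 := by
  simp only [permWeight]
  rw [← Finset.sum_div, ← permanent_eq_sum_rows, div_self h.ne']

theorem apply_ne_zero_of_permWeight_ne_zero {σ : Equiv.Perm (Fin n)} (h : permWeight A σ ≠ 0)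
    (i : Fin n) : A i (σ i) ≠ 0 := fun h0 =>
  h (by rw [permWeight, Finset.prod_eq_zero (Finset.mem_univ i) h0, zero_div])

theorem isInjFamily_permWeight (hA : ∀ i j, 0 ≤ A i j) :
    IsInjFamily (permWeight A) (fun i σ => σ i) Finset.univ Finset.univ where
  nonneg := permWeight_nonneg hA
  mem _ _ _ _ := Finset.mem_univ _
  inj σ _ _ _ _ _ h := σ.injective h
  ext _ _ _ _ h := Equiv.ext fun i => h i (Finset.mem_univ i)

theorem permMarginal_nonneg (hA : ∀ i j, 0 ≤ A i j) (i j : Fin n) : 0 ≤ permMarginal A i j :=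
  marginal_nonneg (permWeight_nonneg hA) _ _

theorem sum_permMarginal_mul (i : Fin n) (f : Fin n → ℝ) :
    ∑ j, permMarginal A i j * f j = ∑ σ, permWeight A σ * f (σ i) := by
  simp only [permMarginal, marginal, condWeight, Finset.sum_mul]
  rw [Finset.sum_comm]
  simp

theorem sum_permMarginal (h : 0 < A.permanent) (i : Fin n) : ∑ j, permMarginal A i j = 1 := by
  simpa [sum_permWeight h] using sum_permMarginal_mul (A := A) i 1

theorem exists_of_permMarginal_ne_zero {i j : Fin n} (h : permMarginal A i j ≠ 0) :
    ∃ σ, permWeight A σ ≠ 0 ∧ σ i = j := by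
  obtain ⟨σ, -, hσ⟩ := Finset.exists_ne_zero_of_sum_ne_zero h
  simp only [condWeight, ne_eq, ite_eq_right_iff, Classical.not_imp] at hσ
  exact ⟨σ, hσ.2, hσ.1⟩

theorem permMarginal_ne_zero (hA : ∀ i j, 0 ≤ A i j) {σ : Equiv.Perm (Fin n)}
    (h : permWeight A σ ≠ 0) (i : Fin n) : permMarginal A i (σ i) ≠ 0 := by
  intro h0
  have := (Finset.sum_eq_zero_iff_of_nonneg
    (fun τ _ => condWeight_nonneg (permWeight_nonneg hA) _ _ τ)).1 h0 σ (Finset.mem_univ _)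
  simp only [condWeight, if_true] at this
  exact h this

theorem log_permanent (h : 0 < A.permanent) :
    log A.permanent = massEntropy Finset.univ (permWeight A) +
      ∑ i, ∑ j, permMarginal A i j * log (A i j) := by
  simp only [sum_permMarginal_mul]
  rw [massEntropy, sum_permWeight h, negMulLog_one, sub_zero, Finset.sum_comm,
    ← Finset.sum_add_distrib]
  have : ∀ σ : Equiv.Perm (Fin n), negMulLog (permWeight A σ) +
      ∑ i, permWeight A σ * log (A i (σ i)) = permWeight A σ * log A.permanent := by
    intro σ
    -- Where an entry vanishes, so does the weight, so the convention log 0 = 0 does no harm.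
    by_cases h0 : permWeight A σ = 0
    · simp [h0]
    have h1 : ∀ i ∈ Finset.univ, A i (σ i) ≠ 0 := fun i _ =>
      apply_ne_zero_of_permWeight_ne_zero h0 i
    rw [← Finset.mul_sum, ← log_prod h1, negMulLog]
    nth_rw 2 [permWeight]
    rw [log_div (Finset.prod_ne_zero_iff.2 h1) h.ne']
    ring
  rw [Finset.sum_congr rfl fun σ _ => this σ, ← Finset.sum_mul, sum_permWeight h, one_mul]

/-- The contribution of the `i`-th row to the logarithm of the upper bound. -/
noncomputable def rowBound (p : ℝ) (A : Matrix (Fin n) (Fin n) ℝ) (i : Fin n) : ℝ :=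
  max 0 ((critRate n - 1 / p) * log n) + 1 / p * log (∑ j, A i j ^ p)

/-- Split the rate as 1/p + (δ - 1/p): Gibbs' inequality with weights A i j ^ p handles the first
part, 0 ≤ H ≤ log n the second. Equality in the sum forces equality in both. -/
theorem row_bound (hp : 1 ≤ p) (hA : ∀ i j, 0 ≤ A i j) (h : 0 < A.permanent) (i : Fin n) :
    critRate n * massEntropy Finset.univ (permMarginal A i) +
        ∑ j, permMarginal A i j * log (A i j) ≤ rowBound p A i ∧
      (critRate n * massEntropy Finset.univ (permMarginal A i) +
        ∑ j, permMarginal A i j * log (A i j) = rowBound p A i →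
        (∀ j, permMarginal A i j = A i j ^ p / ∑ j, A i j ^ p) ∧
        (critRate n < 1 / p → ∃ j, ∀ l, l ≠ j → permMarginal A i l = 0) ∧
        (1 / p < critRate n → ∀ j, permMarginal A i j = 1 / n)) := by
  have hp0 : 0 < p := by linarith
  have hq := fun j (_ : j ∈ Finset.univ) => permMarginal_nonneg hA i j
  have hs := sum_permMarginal h i
  obtain ⟨g1, g2⟩ := gibbs_inequality hq hs (v := fun j => A i j ^ p)
    (fun j _ => rpow_nonneg (hA i j) p) (fun j _ hj => by
      obtain ⟨σ, h1, rfl⟩ := exists_of_permMarginal_ne_zero hj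
      exact (rpow_pos_of_pos (lt_of_le_of_ne (hA i _)
        (apply_ne_zero_of_permWeight_ne_zero h1 i).symm) p).ne')
  obtain ⟨u1, u2⟩ := massEntropy_le_log_card hq hs
  obtain ⟨z1, z2⟩ := massEntropy_nonneg hq hs
  rw [Finset.card_univ, Fintype.card_fin] at u1 u2
  have e : ∑ j, permMarginal A i j * log (A i j ^ p) =
      p * ∑ j, permMarginal A i j * log (A i j) := by
    rw [Finset.mul_sum]
    refine Finset.sum_congr rfl fun j _ => ?_
    rcases (hA i j).eq_or_lt with h0 | h0
    · simp [← h0, zero_rpow hp0.ne']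
    · rw [log_rpow h0]; ring
  rw [e] at g1 g2
  set H := massEntropy Finset.univ (permMarginal A i)
  set L := ∑ j, permMarginal A i j * log (A i j)
  set T := ∑ j, A i j ^ p
  have k1 : 1 / p * H + L ≤ 1 / p * log T := by
    have := mul_le_mul_of_nonneg_left g1 (by positivity : 0 ≤ 1 / p)
    refine le_trans (le_of_eq ?_) this
    field_simp
  have k2 : (critRate n - 1 / p) * H ≤ max 0 ((critRate n - 1 / p) * log n) := by
    rcases le_total 0 (critRate n - 1 / p) with hk | hk
    · exact le_max_of_le_right (mul_le_mul_of_nonneg_left u1 hk)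
    · exact le_max_of_le_left (mul_nonpos_of_nonpos_of_nonneg hk z1)
  rw [rowBound]
  refine ⟨by linarith, fun heq => ?_⟩
  have k3 : 1 / p * H + L = 1 / p * log T := by linarith
  have k4 : (critRate n - 1 / p) * H = max 0 ((critRate n - 1 / p) * log n) := by linarith
  refine ⟨fun j => g2 ?_ j (Finset.mem_univ j), fun hlt => ?_, fun hlt j => ?_⟩
  · field_simp at k3
    linarith
  · have : H = 0 := by
      have := le_max_left 0 ((critRate n - 1 / p) * log n)
      nlinarith
    obtain ⟨j, -, hj⟩ := z2 this
    exact ⟨j, fun l hl => hj l (Finset.mem_univ l) hl⟩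
  · refine u2 ?_ j (Finset.mem_univ j)
    rw [max_eq_right (mul_nonneg (by linarith) (log_natCast_nonneg n))] at k4
    exact mul_left_cancel₀ (by linarith) k4

theorem log_permanent_le (hA : ∀ i j, 0 ≤ A i j) (h : 0 < A.permanent) :
    log A.permanent ≤ ∑ i, (critRate n * massEntropy Finset.univ (permMarginal A i) +
      ∑ j, permMarginal A i j * log (A i j)) := by
  rw [log_permanent h, Finset.sum_add_distrib, ← Finset.mul_sum]
  gcongr
  exact massEntropy_le_critRate n _ _ _ (isInjFamily_permWeight hA) (by simp) (by simp)

theorem sum_rpow_pos (hA : ∀ i j, 0 ≤ A i j) {i : Fin n} (h : A i ≠ 0) :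
    0 < ∑ j, A i j ^ p := by
  obtain ⟨j, hj⟩ := Function.ne_iff.1 h
  exact Finset.sum_pos' (fun j _ => rpow_nonneg (hA i j) p)
    ⟨j, Finset.mem_univ j, rpow_pos_of_pos (lt_of_le_of_ne (hA i j) (Ne.symm hj)) p⟩

theorem row_ne_zero_of_permanent_pos (h : 0 < A.permanent) (i : Fin n) : A i ≠ 0 := by
  intro h0
  refine h.ne' ?_
  rw [permanent_eq_sum_rows]
  exact Finset.sum_eq_zero fun σ _ => Finset.prod_eq_zero (Finset.mem_univ i) (congrFun h0 _)

theorem norm_row_pos (hp : 1 ≤ p) (hA : ∀ i j, 0 ≤ A i j) {i : Fin n} (h : A i ≠ 0) :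
    0 < ‖WithLp.toLp (ENNReal.ofReal p) (A i)‖ := by
  rw [norm_toLp_of_nonneg hp (hA i)]
  exact rpow_pos_of_pos (sum_rpow_pos hA h) _

theorem log_bound (hp : 1 ≤ p) (hA : ∀ i j, 0 ≤ A i j) (h : ∀ i, A i ≠ 0) :
    log (max 1 (onesRatio n p) * ∏ i, ‖WithLp.toLp (ENNReal.ofReal p) (A i)‖) =
      ∑ i, rowBound p A i := by
  have h1 : ∀ i ∈ Finset.univ, ‖WithLp.toLp (ENNReal.ofReal p) (A i)‖ ≠ 0 := fun i _ =>
    (norm_row_pos hp hA (h i)).ne'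
  rw [log_mul (lt_max_of_lt_left one_pos).ne' (Finset.prod_ne_zero_iff.2 h1), log_prod h1,
    log_max_onesRatio]
  simp only [rowBound, Finset.sum_add_distrib, Finset.sum_const, Finset.card_univ,
    Fintype.card_fin, nsmul_eq_mul]
  congr 1
  refine Finset.sum_congr rfl fun i _ => ?_
  rw [norm_toLp_of_nonneg hp (hA i), log_rpow (sum_rpow_pos hA (h i))]

theorem bound_pos (hp : 1 ≤ p) (hA : ∀ i j, 0 ≤ A i j) (h : ∀ i, A i ≠ 0) :
    0 < max 1 (onesRatio n p) * ∏ i, ‖WithLp.toLp (ENNReal.ofReal p) (A i)‖ :=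
  mul_pos (lt_max_of_lt_left one_pos) (Finset.prod_pos fun i _ => norm_row_pos hp hA (h i))

theorem permanent_le (hp : 1 ≤ p) (hA : ∀ i j, 0 ≤ A i j) :
    A.permanent ≤ max 1 (onesRatio n p) * ∏ i, ‖WithLp.toLp (ENNReal.ofReal p) (A i)‖ := by
  rcases (permanent_nonneg hA).eq_or_lt with h | h
  · rw [← h]
    exact mul_nonneg (le_max_of_le_left zero_le_one) (Finset.prod_nonneg fun i _ => by
      rw [norm_toLp_of_nonneg hp (hA i)]
      exact rpow_nonneg (Finset.sum_nonneg fun j _ => rpow_nonneg (hA i j) p) _)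
  have hr := row_ne_zero_of_permanent_pos h
  rw [← log_le_log_iff h (bound_pos hp hA hr), log_bound hp hA hr]
  exact (log_permanent_le hA h).trans (Finset.sum_le_sum fun i _ => (row_bound hp hA h i).1)

/-! ### Equality cases -/

theorem eq_diagonal_mul_perm (hA : ∀ i j, 0 ≤ A i j) (h : 0 < A.permanent)
    (hv : ∀ i, ∃ j, ∀ l, l ≠ j → A i l = 0) :
    ∃ (c : Fin n → ℝ) (σ : Equiv.Perm (Fin n)), (∀ i, 0 < c i) ∧
      A = Matrix.diagonal c * (1 : Matrix (Fin n) (Fin n) ℝ).submatrix σ id := by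
  obtain ⟨σ, -, hσ⟩ := Finset.exists_ne_zero_of_sum_ne_zero
    ((sum_permWeight h).trans_ne one_ne_zero)
  have hσ' := apply_ne_zero_of_permWeight_ne_zero hσ
  refine ⟨fun i => A i (σ i), σ, fun i => lt_of_le_of_ne (hA i _) (hσ' i).symm, ?_⟩
  ext i l
  rw [Matrix.diagonal_mul, Matrix.submatrix_apply, id, Matrix.one_apply]
  obtain ⟨j, hj⟩ := hv i
  have hσj : σ i = j := by
    by_contra hne
    exact hσ' i (hj _ hne)
  split_ifs with hl
  · rw [← hl, mul_one]
  · rw [mul_zero]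
    exact hj l fun e => hl (hσj.trans e.symm)

theorem eq_diagonal_mul_ones (hA : ∀ i j, 0 ≤ A i j) (hr : ∀ i, A i ≠ 0)
    (hu : ∀ i j l, A i j = A i l) :
    ∃ c : Fin n → ℝ, (∀ i, 0 < c i) ∧
      A = Matrix.diagonal c * Matrix.of fun _ _ => (1 : ℝ) := by
  refine ⟨fun i => A i i, fun i => lt_of_le_of_ne (hA i i) fun h0 => hr i ?_, ?_⟩
  · funext j
    exact (hu i j i).trans h0.symm
  · ext i j
    rw [Matrix.diagonal_mul, Matrix.of_apply, mul_one, hu i j i]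

theorem eq_of_permanent_eq (hp : 1 ≤ p) (hA : ∀ i j, 0 ≤ A i j) (hnp : ¬ (n = 2 ∧ p = 2))
    (hr : ∀ i, A i ≠ 0)
    (heq : A.permanent =
      max 1 (onesRatio n p) * ∏ i, ‖WithLp.toLp (ENNReal.ofReal p) (A i)‖) :
    (onesRatio n p ≤ 1 ∧ ∃ (c : Fin n → ℝ) (σ : Equiv.Perm (Fin n)), (∀ i, 0 < c i) ∧
      A = Matrix.diagonal c * (1 : Matrix (Fin n) (Fin n) ℝ).submatrix σ id) ∨
    (1 ≤ onesRatio n p ∧ ∃ c : Fin n → ℝ, (∀ i, 0 < c i) ∧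
      A = Matrix.diagonal c * Matrix.of fun _ _ => (1 : ℝ)) := by
  have hp0 : 0 < p := by linarith
  have h : 0 < A.permanent := heq ▸ bound_pos hp hA hr
  have hlog := congrArg log heq
  rw [log_bound hp hA hr] at hlog
  have hrow := fun i (_ : i ∈ Finset.univ) => row_bound hp hA h i
  have hle := log_permanent_le hA h
  have hrow' := fun i => (row_bound hp hA h i).2 ((Finset.sum_eq_sum_iff_of_le
    fun i hi => (hrow i hi).1).1 (le_antisymm (Finset.sum_le_sum fun i hi => (hrow i hi).1)
      (hlog ▸ hle)) i (Finset.mem_univ i))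
  have hzero : ∀ i l, permMarginal A i l = 0 → A i l = 0 := by
    intro i l h0
    rw [(hrow' i).1 l, div_eq_zero_iff] at h0
    exact ((rpow_eq_zero_iff_of_nonneg (hA i l)).1
      (h0.resolve_right (sum_rpow_pos hA (hr i)).ne')).1
  have hconst : ∀ i j l, permMarginal A i j = permMarginal A i l → A i j = A i l := by
    intro i j l h0
    rw [(hrow' i).1 j, (hrow' i).1 l, div_left_inj' (sum_rpow_pos hA (hr i)).ne'] at h0
    exact (rpow_left_inj (hA i j) (hA i l) hp0.ne').1 h0
  have hpt : (∀ i, ∃ j, ∀ l, l ≠ j → permMarginal A i l = 0) →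
      ∃ (c : Fin n → ℝ) (σ : Equiv.Perm (Fin n)), (∀ i, 0 < c i) ∧
        A = Matrix.diagonal c * (1 : Matrix (Fin n) (Fin n) ℝ).submatrix σ id := fun hv =>
    eq_diagonal_mul_perm hA h fun i => (hv i).imp fun j hj l hl => hzero i l (hj l hl)
  have hun : (∀ i j l, permMarginal A i j = permMarginal A i l) →
      ∃ c : Fin n → ℝ, (∀ i, 0 < c i) ∧ A = Matrix.diagonal c * Matrix.of fun _ _ => (1 : ℝ) :=
    fun hu => eq_diagonal_mul_ones hA hr fun i j l => hconst i j l (hu i j l)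
  have hle1 : critRate n ≤ 1 / p → onesRatio n p ≤ 1 := fun hc => by
    rw [← log_nonpos_iff (onesRatio_pos n p).le, log_onesRatio]
    exact mul_nonpos_of_nonneg_of_nonpos n.cast_nonneg
      (mul_nonpos_of_nonpos_of_nonneg (by linarith) (log_natCast_nonneg n))
  have hge1 : 1 / p ≤ critRate n → 1 ≤ onesRatio n p := fun hc => by
    rw [← log_nonneg_iff (onesRatio_pos n p), log_onesRatio]
    exact mul_nonneg n.cast_nonneg (mul_nonneg (by linarith) (log_natCast_nonneg n))
  rcases lt_trichotomy (critRate n) (1 / p) with hc | hc | hc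
  · exact Or.inl ⟨hle1 hc.le, hpt fun i => (hrow' i).2.1 hc⟩
  swap
  · refine Or.inr ⟨hge1 hc.le, hun fun i j l => ?_⟩
    rw [(hrow' i).2.2 hc j, (hrow' i).2.2 hc l]
  -- At the critical rate 1/p > 0 excludes n ≤ 1, where `critRate` is 0, and n = 2 would force p =
  -- 2.
  have hn : 3 ≤ n := by
    by_contra hn
    have hd : 0 < critRate n := by rw [hc]; positivity
    have : n = 0 ∨ n = 1 ∨ n = 2 := by omega
    rcases this with rfl | rfl | rfl
    · simp [critRate] at hd
    · simp [critRate] at hd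
    · refine hnp ⟨rfl, ?_⟩
      have h2 := (log_pos (by norm_num : (1 : ℝ) < 2)).ne'
      have h3 : critRate 2 = 1 / 2 := by
        simp only [critRate, Nat.factorial_two, Nat.cast_ofNat]
        field_simp
      rw [h3] at hc
      field_simp at hc
      linarith
  have hpu := isPointOrUniform_of_massEntropy_eq (isInjFamily_permWeight hA) (m := n) (by simp)
    (by simp) hn (by
      refine le_antisymm (massEntropy_le_critRate n _ _ _ (isInjFamily_permWeight hA) (by simp)
        (by simp)) ?_
      have h1 := Finset.sum_le_sum fun i hi => (hrow i hi).1
      rw [← hlog, log_permanent h, Finset.sum_add_distrib, ← Finset.mul_sum] at h1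
      exact le_of_add_le_add_right h1)
  by_cases hall : ∀ i, ∃ j, ∀ l, l ≠ j → permMarginal A i l = 0
  · exact Or.inl ⟨hle1 hc.le, hpt hall⟩
  refine Or.inr ⟨hge1 hc.ge, hun ?_⟩
  push Not at hall
  obtain ⟨i₀, hi₀⟩ := hall
  -- A law that is not a point mass is uniform, hence has full support.
  have hpos : ∀ j, permMarginal A i₀ j ≠ 0 := by
    rcases hpu i₀ (Finset.mem_univ _) with ⟨j, -, hj⟩ | ⟨c, hc⟩
    · obtain ⟨l, hl, hl0⟩ := hi₀ j
      exact absurd (hj l (Finset.mem_univ l) hl) hl0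
    · obtain ⟨l, -, hl0⟩ := hi₀ i₀
      intro j hj
      exact hl0 ((hc l (Finset.mem_univ l)).trans ((hc j (Finset.mem_univ j)).symm.trans hj))
  intro i j l
  by_cases hi : i = i₀
  · subst hi
    rcases hpu i (Finset.mem_univ _) with ⟨j, -, hj⟩ | ⟨c, hc⟩
    · obtain ⟨l, hl, hl0⟩ := hi₀ j
      exact absurd (hj l (Finset.mem_univ l) hl) hl0
    · exact (hc j (Finset.mem_univ j)).trans (hc l (Finset.mem_univ l)).symm
  · rcases hpu i (Finset.mem_univ _) with ⟨k, -, hk⟩ | ⟨c, hc⟩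
    · obtain ⟨σ, hσ, hσk⟩ := exists_of_permMarginal_ne_zero (hpos k)
      refine absurd (hk (σ i) (Finset.mem_univ _) fun e => hi ?_) (permMarginal_ne_zero hA hσ i)
      exact σ.injective (e.trans hσk.symm)
    · exact (hc j (Finset.mem_univ j)).trans (hc l (Finset.mem_univ l)).symm

theorem permanent_diagonal_mul_perm (hp : 1 ≤ p) {c : Fin n → ℝ} (hc : ∀ i, 0 < c i)
    (σ : Equiv.Perm (Fin n))
    (hA : A = Matrix.diagonal c * (1 : Matrix (Fin n) (Fin n) ℝ).submatrix σ id) :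
    A.permanent = ∏ i, ‖WithLp.toLp (ENNReal.ofReal p) (A i)‖ := by
  have hp0 : p ≠ 0 := by linarith
  have e : ∀ i j, A i j = if σ i = j then c i else 0 := by
    intro i j
    rw [hA, Matrix.diagonal_mul, Matrix.submatrix_apply, id, Matrix.one_apply, mul_ite, mul_one,
      mul_zero]
  rw [permanent_eq_sum_rows, Finset.sum_eq_single σ]
  · refine Finset.prod_congr rfl fun i _ => ?_
    rw [norm_toLp_of_nonneg hp fun j => by rw [e]; split_ifs <;> simp [(hc i).le]]
    simp only [e, if_true, apply_ite (· ^ p), zero_rpow hp0, Finset.sum_ite_eq,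
      Finset.mem_univ]
    rw [← rpow_mul (hc i).le, mul_one_div_cancel hp0, rpow_one]
  · intro τ _ hτ
    obtain ⟨i, hi⟩ := not_forall.1 (mt Equiv.ext hτ)
    exact Finset.prod_eq_zero (Finset.mem_univ i) (by rw [e, if_neg (Ne.symm hi)])
  · simp

theorem permanent_diagonal_mul_ones (hp : 1 ≤ p) {c : Fin n → ℝ} (hc : ∀ i, 0 < c i)
    (hA : A = Matrix.diagonal c * Matrix.of fun _ _ => (1 : ℝ)) :
    A.permanent = onesRatio n p * ∏ i, ‖WithLp.toLp (ENNReal.ofReal p) (A i)‖ := by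
  have hp0 : p ≠ 0 := by linarith
  have e : ∀ i j, A i j = c i := by
    intro i j
    rw [hA, Matrix.diagonal_mul, Matrix.of_apply, mul_one]
  have hnorm : ∀ i, ‖WithLp.toLp (ENNReal.ofReal p) (A i)‖ = (n : ℝ) ^ (1 / p) * c i := by
    intro i
    rw [norm_toLp_of_nonneg hp fun j => by rw [e]; exact (hc i).le]
    simp only [e, Finset.sum_const, Finset.card_univ, Fintype.card_fin, nsmul_eq_mul]
    rw [mul_rpow n.cast_nonneg (rpow_nonneg (hc i).le p), ← rpow_mul (hc i).le,
      mul_one_div_cancel hp0, rpow_one]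
  rw [permanent_eq_sum_rows]
  simp only [e, hnorm, Finset.prod_mul_distrib, Finset.sum_const, Finset.prod_const,
    Finset.card_univ, Fintype.card_fin, Fintype.card_perm, nsmul_eq_mul, onesRatio]
  rw [← rpow_mul_natCast n.cast_nonneg, one_div_mul_eq_div, ← mul_assoc,
    div_mul_cancel₀ _ (natCast_rpow_pos n p).ne']

end Permanent

theorem mainTheorem2 (n : ℕ) (p : ℝ) (hp : 1 ≤ p) (A : Matrix (Fin n) (Fin n) ℝ)
    (hA : ∀ i j, 0 ≤ A i j) :
    A.permanent ≤ max 1 ((n.factorial : ℝ) / (n : ℝ) ^ ((n : ℝ) / p)) *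
        ∏ i, ‖WithLp.toLp (ENNReal.ofReal p) (A i)‖ ∧
      (¬ (n = 2 ∧ p = 2) → (∀ i, A i ≠ 0) →
        (A.permanent = max 1 ((n.factorial : ℝ) / (n : ℝ) ^ ((n : ℝ) / p)) *
            ∏ i, ‖WithLp.toLp (ENNReal.ofReal p) (A i)‖ ↔
          ((n.factorial : ℝ) / (n : ℝ) ^ ((n : ℝ) / p) ≤ 1 ∧
            ∃ (c : Fin n → ℝ) (σ : Equiv.Perm (Fin n)), (∀ i, 0 < c i) ∧
              A = Matrix.diagonal c * (1 : Matrix (Fin n) (Fin n) ℝ).submatrix σ id) ∨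
          (1 ≤ (n.factorial : ℝ) / (n : ℝ) ^ ((n : ℝ) / p) ∧
            ∃ c : Fin n → ℝ, (∀ i, 0 < c i) ∧
              A = Matrix.diagonal c * Matrix.of fun _ _ => (1 : ℝ)))) := by
  refine ⟨permanent_le hp hA, fun hnp hr => ⟨eq_of_permanent_eq hp hA hnp hr, ?_⟩⟩
  rintro (⟨ht, c, σ, hc, hAc⟩ | ⟨ht, c, hc, hAc⟩)
  · rw [max_eq_left ht, one_mul]
    exact permanent_diagonal_mul_perm hp hc σ hAc
  · rw [max_eq_right ht]
    exact permanent_diagonal_mul_ones hp hc hAc
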